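/- Graphs are undirected; loops are allowed, multiple edges are not, and vertex sets may be infinite unless the contrary is said. $K_n$ is the loopless complete graph on $n$ vertices, and $\chi(G)\in\mathbb N\cup\{\infty\}$ is the least $n$ for which there is a graph homomorphism $G\to K_n$ ($\infty$ if there is none). A graph homomorphism is called proper if every vertex has finitely many preimages (this is automatic if the source is finite). For graphs $T,G$, the cells of the complex $\mathrm{Hom}(T,G)$ are the functions $\eta$ assigning to each vertex of $T$ a nonempty finite set of vertices of $G$, with $|\eta(x)|\ge 2$ for only finitely many $x$, such that $\eta(x)\times\eta(y)\subseteq E(G)$ for every edge $(x,y)$ of $T$; the cell $\eta$ is the product of the simplices $\eta(x)$, and the cells are ordered by $\tilde\eta\le\eta$ iff $\tilde\eta(x)\subseteq\eta(x)$ for all $x$. If $\gamma$ is an involution of $T$ that flips an edge (there is an edge $(x,y)$ with $\gamma(x)=y$, $\gamma(y)=x$) and $G$ has no loops, then $\eta\mapsto\eta\circ\gamma$ makes $\mathrm{Hom}(T,G)$ a free $\mathbb Z_2$-space. For a free $\mathbb Z_2$-space $X$ (a complex with a free involution) let $w:X\to S^\infty$ be a $\mathbb Z_2$-map to the infinite sphere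 with the antipodal action, $z$ the generator of $H^1(\mathbb{RP}^\infty;\mathbb Z_2)$, and $\varpi_1(X)=(w/\mathbb Z_2)^*(z)\in H^1(X/\mathbb Z_2;\mathbb Z_2)$ the Stiefel–Whitney class of $X$. The height $\mathtt h(X)$ is the largest integer $h\ge 0$ with $\varpi_1^h(X)\ne 0$. A graph $T$ with a $\mathbb Z_2$-action that flips an edge is called a Stiefel–Whitney test graph if $\mathtt h(\mathrm{Hom}(T,K_n))=n-\chi(T)$ for every integer $n\ge\chi(T)$. **Proposition.** (1) Let $A$, $T$, $B$ be graphs with $\mathbb Z_2$-actions such that $A$ and $B$ are Stiefel–Whitney test graphs and $\chi(T)=\chi(A)=\chi(B)$. If there are proper $\mathbb Z_2$-equivariant graph homomorphisms $\varphi:A\to T$ and $\psi:T\to B$, then $T$ is a Stiefel–Whitney test graph. (2) Every finite connected bipartite graph with a $\mathbb Z_2$-action that flips an edge is a Stiefel–Whitney test graph. -/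

import Mathlib

open CategoryTheory Opposite

universe u v

/-! ### Graphs: undirected, loops allowed, no multiple edges -/

/-- An undirected graph on the vertex set `V`; loops are allowed, multiple edges are not. -/
structure LGraph (V : Type u) where
  Adj : V → V → Prop
  symm : ∀ x y, Adj x y → Adj y x

namespace LGraph

variable {V : Type u} {W : Type v}

/-- A graph homomorphism: a vertex map sending edges to edges. -/
structure Hom (G : LGraph V) (H : LGraph W) where
  toFun : V → W
  map_adj : ∀ x y, G.Adj x y → H.Adj (toFun x) (toFun y)

/-- A homomorphism is proper if all its fibres are finite. -/
def Hom.Proper {G : LGraph V} {H : LGraph W} (φ : Hom G H) : Prop :=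
  ∀ w : W, {x : V | φ.toFun x = w}.Finite

/-- The unlooped complete graph on `n` vertices. -/
def complete (n : ℕ) : LGraph (Fin n) where
  Adj x y := x ≠ y
  symm _ _ h := h.symm

/-- The least number of colours of a vertex-colouring, `⊤` if there is no finite one. -/
noncomputable def chromaticNumber (G : LGraph V) : ℕ∞ :=
  ⨅ n ∈ {n : ℕ | Nonempty (Hom G (complete n))}, (n : ℕ∞)

def Loopless (G : LGraph V) : Prop := ∀ x, ¬ G.Adj x x

/-- The graph has a vertex, and any two vertices are joined by a walk. -/
def Connected (G : LGraph V) : Prop :=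
  Nonempty V ∧ ∀ x y, Relation.ReflTransGen G.Adj x y

/-- The vertex set splits into two parts such that every edge joins the two parts. -/
def Bipartite (G : LGraph V) : Prop :=
  ∃ S : Set V, ∀ x y, G.Adj x y → (x ∈ S ↔ y ∉ S)

theorem complete_loopless (n : ℕ) : (complete n).Loopless := fun _ h => h rfl

/-- The cells of the complex `Hom(T, G)`: functions `η` assigning to each vertex of `T` a nonempty
finite set of vertices of `G` (a simplex), with only finitely many of these simplices of positive
dimension, such that `η x × η y ⊆ E(G)` for every edge `(x, y)` of `T`. -/
structure HomCell (T : LGraph V) (G : LGraph W) where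
  toFun : V → Finset W
  nonempty : ∀ x, (toFun x).Nonempty
  finite : {x : V | 1 < (toFun x).card}.Finite
  adj : ∀ x y, T.Adj x y → ∀ a ∈ toFun x, ∀ b ∈ toFun y, G.Adj a b

theorem HomCell.toFun_injective {T : LGraph V} {G : LGraph W} :
    Function.Injective (HomCell.toFun : HomCell T G → V → Finset W) := by
  rintro ⟨f, _, _, _⟩ ⟨g, _, _, _⟩ h
  cases h
  rfl

/-- The face poset of `Hom(T, G)`: cells ordered by `η ≤ η'` iff `η x ⊆ η' x` for all `x`. -/
instance (T : LGraph V) (G : LGraph W) : PartialOrder (HomCell T G) :=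
  PartialOrder.lift HomCell.toFun HomCell.toFun_injective

end LGraph

/-! ### Graphs with an involution -/

/-- A graph with a `ℤ/2`-action, given by the automorphism by which the generator acts. -/
structure Z2Graph (V : Type u) extends LGraph V where
  invol : V → V
  invol_invol : ∀ x, invol (invol x) = x
  invol_adj : ∀ x y, Adj x y → Adj (invol x) (invol y)

namespace Z2Graph

variable {V : Type u} {W : Type v}

/-- The action flips an edge `(x, y)`, i.e. interchanges its end points. -/
def FlipsEdge (T : Z2Graph V) : Prop :=
  ∃ x y, T.Adj x y ∧ T.invol x = y ∧ T.invol y = x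

/-- The homomorphism commutes with the involutions. -/
def Equivariant {S : Z2Graph V} {T : Z2Graph W} (φ : LGraph.Hom S.toLGraph T.toLGraph) : Prop :=
  ∀ x, φ.toFun (S.invol x) = T.invol (φ.toFun x)

/-- The action of the involution of `T` on the cells of `Hom(T, G)`, `η ↦ η ∘ γ`. -/
def cellInvol (T : Z2Graph V) (G : LGraph W) (η : LGraph.HomCell T.toLGraph G) :
    LGraph.HomCell T.toLGraph G where
  toFun x := η.toFun (T.invol x)
  nonempty _ := η.nonempty _
  finite := Set.Finite.preimage (f := T.invol)
    (Function.LeftInverse.injective (g := T.invol) T.invol_invol).injOn η.finite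
  adj x y h := η.adj _ _ (T.invol_adj x y h)

theorem cellInvol_monotone (T : Z2Graph V) (G : LGraph W) : Monotone (T.cellInvol G) :=
  fun _ _ h x => h (T.invol x)

theorem cellInvol_cellInvol (T : Z2Graph V) (G : LGraph W) (η : LGraph.HomCell T.toLGraph G) :
    T.cellInvol G (T.cellInvol G η) = η :=
  LGraph.HomCell.toFun_injective (funext fun x => congrArg η.toFun (T.invol_invol x))

theorem cellInvol_ne (T : Z2Graph V) (hT : T.FlipsEdge) (G : LGraph W) (hG : G.Loopless)
    (η : LGraph.HomCell T.toLGraph G) : T.cellInvol G η ≠ η := by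
  intro h
  obtain ⟨x, y, hxy, hx, -⟩ := hT
  obtain ⟨a, ha⟩ := η.nonempty x
  have h1 : η.toFun (T.invol x) = η.toFun x := congrFun (congrArg LGraph.HomCell.toFun h) x
  rw [hx] at h1
  exact hG a (η.adj x y hxy a ha a (h1 ▸ ha))

end Z2Graph

/-! ### Simplicial cohomology with coefficients in `ℤ/2` -/

namespace SSet

/-- Simplicial cochains with coefficients in `ℤ/2`. -/
abbrev Z2Cochain (X : SSet.{u}) (n : ℕ) : Type u := X.obj (op (SimplexCategory.mk n)) → ZMod 2

/-- The coboundary (no signs are needed modulo 2). -/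
def z2d (X : SSet.{u}) (n : ℕ) : Z2Cochain X n →ₗ[ZMod 2] Z2Cochain X (n + 1) where
  toFun f σ := ∑ i : Fin (n + 2), f (X.δ i σ)
  map_add' f g := by
    funext σ
    simp [Finset.sum_add_distrib]
  map_smul' c f := by
    funext σ
    simp [Finset.mul_sum]

def z2Cocycles (X : SSet.{u}) (n : ℕ) : Submodule (ZMod 2) (Z2Cochain X n) :=
  LinearMap.ker (z2d X n)

def z2Coboundaries (X : SSet.{u}) : (n : ℕ) → Submodule (ZMod 2) (Z2Cochain X n)
  | 0 => ⊥
  | n + 1 => LinearMap.range (z2d X n)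

/-- `Hⁿ(X; ℤ/2)`, cocycles modulo coboundaries. -/
abbrev Z2Cohomology (X : SSet.{u}) (n : ℕ) : Type u :=
  z2Cocycles X n ⧸ (z2Coboundaries X n).submoduleOf (z2Cocycles X n)

/-- The cup product of cochains: front face times back face. -/
def z2Cup {X : SSet.{u}} {p q : ℕ} (f : Z2Cochain X p) (g : Z2Cochain X q) :
    Z2Cochain X (p + q) :=
  fun σ => f (X.map (SimplexCategory.subinterval 0 p (by omega)).op σ) *
    g (X.map (SimplexCategory.subinterval p q le_rfl).op σ)

/-- The cup powers of a 1-cochain. -/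
def z2CupPow {X : SSet.{u}} (f : Z2Cochain X 1) : (k : ℕ) → Z2Cochain X k
  | 0 => fun _ => 1
  | k + 1 => z2Cup (z2CupPow f k) f

/-- The pullback of cochains along a simplicial map. -/
def z2Pull {X Y : SSet.{u}} (φ : X ⟶ Y) {n : ℕ} (f : Z2Cochain Y n) : Z2Cochain X n :=
  fun σ => f (φ.app (op (SimplexCategory.mk n)) σ)

theorem z2Pull_mem {X Y : SSet.{u}} (φ : X ⟶ Y) {n : ℕ} {f : Z2Cochain Y n}
    (hf : f ∈ z2Cocycles Y n) : z2Pull φ f ∈ z2Cocycles X n := by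
  have h0 : z2d Y n f = 0 := hf
  change z2d X n (z2Pull φ f) = 0
  funext σ
  have h := congrFun h0 (φ.app (op (SimplexCategory.mk (n + 1))) σ)
  simp only [z2d, LinearMap.coe_mk, AddHom.coe_mk, Pi.zero_apply, z2Pull] at h ⊢
  rw [← h]
  refine Finset.sum_congr rfl fun i _ => congrArg f ?_
  exact SSet.δ_naturality_apply φ i σ

theorem map_op_map_op (X : SSet.{u}) {a b c : SimplexCategory} (α : a ⟶ b) (β : b ⟶ c)
    (σ : X.obj (op c)) : X.map α.op (X.map β.op σ) = X.map (α ≫ β).op σ := by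
  rw [op_comp, Functor.map_comp_apply]

theorem subinterval_comp_δ {n l : ℕ} (j : ℕ) (h : j + l ≤ n) (i : Fin (n + 2))
    (γ : SimplexCategory.mk l ⟶ SimplexCategory.mk (n + 1))
    (hγ : ∀ x : Fin (l + 1), (γ.toOrderHom x : ℕ) =
      if x.1 + j < i.1 then x.1 + j else x.1 + j + 1) :
    SimplexCategory.subinterval j l h ≫ SimplexCategory.δ i = γ := by
  apply SimplexCategory.Hom.ext
  ext x : 2
  apply Fin.ext
  rw [hγ]
  change ((Fin.succAbove i ⟨x.1 + j, _⟩ : Fin (n + 2)) : ℕ) = _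
  simp only [Fin.succAbove, Fin.lt_def, Fin.val_castSucc]
  split_ifs <;> rfl

theorem δ_comp_subinterval_apply {m n : ℕ} (j : ℕ) (h : j + (m + 1) ≤ n) (i : Fin (m + 2))
    (x : Fin (m + 1)) :
    ((SimplexCategory.δ i ≫ SimplexCategory.subinterval j (m + 1) h).toOrderHom x : ℕ) =
      (if x.1 < i.1 then x.1 else x.1 + 1) + j := by
  change ((Fin.succAbove i x : Fin (m + 2)) : ℕ) + j = _
  simp only [Fin.succAbove, Fin.lt_def, Fin.val_castSucc]
  split_ifs <;> rfl

theorem subinterval_apply {n : ℕ} (j l : ℕ) (h : j + l ≤ n) (x : Fin (l + 1)) :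
    ((SimplexCategory.subinterval j l h).toOrderHom x : ℕ) = x.1 + j := rfl

theorem z2Cup_mem {X : SSet.{u}} {p : ℕ} {f : Z2Cochain X p} {g : Z2Cochain X 1}
    (hf : f ∈ z2Cocycles X p) (hg : g ∈ z2Cocycles X 1) :
    z2Cup f g ∈ z2Cocycles X (p + 1) := by
  have hf0 : z2d X p f = 0 := hf
  have hg0 : z2d X 1 g = 0 := hg
  change z2d X (p + 1) (z2Cup f g) = 0
  funext σ
  have h1 := congrFun hf0
    (X.map (SimplexCategory.subinterval (n := p + 1 + 1) 0 (p + 1) (by omega)).op σ)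
  have h2 := congrFun hg0
    (X.map (SimplexCategory.subinterval (n := p + 1 + 1) p 2 (by omega)).op σ)
  simp only [z2d, LinearMap.coe_mk, AddHom.coe_mk, Pi.zero_apply, z2Cup, SimplicialObject.δ,
    map_op_map_op] at h1 h2 ⊢
  rw [Fin.sum_univ_castSucc] at h1
  rw [Fin.sum_univ_three] at h2
  rw [Fin.sum_univ_castSucc, Fin.sum_univ_castSucc]
  have e0 : ∀ i : Fin (p + 1),
      SimplexCategory.subinterval (n := p + 1) 0 p (by omega) ≫
          SimplexCategory.δ i.castSucc.castSucc =
        SimplexCategory.δ i.castSucc ≫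
          SimplexCategory.subinterval (n := p + 1 + 1) 0 (p + 1) (by omega) := fun i =>
    subinterval_comp_δ _ _ _ _ fun x => by
      rw [δ_comp_subinterval_apply]; simp
  have e1 : ∀ i : Fin (p + 1),
      SimplexCategory.subinterval (n := p + 1) p 1 (by omega) ≫
          SimplexCategory.δ i.castSucc.castSucc =
        SimplexCategory.δ 0 ≫
          SimplexCategory.subinterval (n := p + 1 + 1) p 2 (by omega) := fun i =>
    subinterval_comp_δ _ _ _ _ fun x => by
      rw [δ_comp_subinterval_apply, if_neg (by simp), if_neg (by simp; omega)]; omega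
  have e2 : SimplexCategory.subinterval (n := p + 1) 0 p (by omega) ≫
          SimplexCategory.δ (Fin.last (p + 1)).castSucc =
        SimplexCategory.δ (Fin.last (p + 1)) ≫
          SimplexCategory.subinterval (n := p + 1 + 1) 0 (p + 1) (by omega) :=
    subinterval_comp_δ _ _ _ _ fun x => by
      rw [δ_comp_subinterval_apply]; simp
  have e3 : SimplexCategory.subinterval (n := p + 1) 0 p (by omega) ≫
          SimplexCategory.δ (Fin.last (p + 1 + 1)) =
        SimplexCategory.δ (Fin.last (p + 1)) ≫
          SimplexCategory.subinterval (n := p + 1 + 1) 0 (p + 1) (by omega) :=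
    subinterval_comp_δ _ _ _ _ fun x => by
      rw [δ_comp_subinterval_apply, if_pos (by simp; omega), if_pos (by simp)]
  have e4 : SimplexCategory.subinterval (n := p + 1) p 1 (by omega) ≫
          SimplexCategory.δ (Fin.last (p + 1)).castSucc =
        SimplexCategory.δ 1 ≫
          SimplexCategory.subinterval (n := p + 1 + 1) p 2 (by omega) :=
    subinterval_comp_δ _ _ _ _ fun x => by
      rw [δ_comp_subinterval_apply]
      have : ((1 : Fin (1 + 2)) : ℕ) = 1 := rfl
      simp only [this, Fin.val_castSucc, Fin.val_last]
      split_ifs <;> omega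
  have e5 : SimplexCategory.subinterval (n := p + 1) p 1 (by omega) ≫
          SimplexCategory.δ (Fin.last (p + 1 + 1)) =
        SimplexCategory.δ 2 ≫
          SimplexCategory.subinterval (n := p + 1 + 1) p 2 (by omega) :=
    subinterval_comp_δ _ _ _ _ fun x => by
      rw [δ_comp_subinterval_apply]
      have : ((2 : Fin (1 + 2)) : ℕ) = 2 := rfl
      simp only [this, Fin.val_last]
      split_ifs <;> omega
  simp only [e0, e1, e2, e3, e4, e5]
  rw [← Finset.sum_mul, eq_neg_of_add_eq_zero_left h1, ZMod.neg_eq_self_mod_two, ← mul_add,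
    ← mul_add, h2, mul_zero]

theorem z2CupPow_mem {X : SSet.{u}} {f : Z2Cochain X 1} (hf : f ∈ z2Cocycles X 1) (k : ℕ) :
    z2CupPow f k ∈ z2Cocycles X k := by
  induction k with
  | zero =>
    change z2d X 0 _ = 0
    funext σ
    simp only [z2d, LinearMap.coe_mk, AddHom.coe_mk, z2CupPow]
    rfl
  | succ k ih => exact z2Cup_mem ih hf

end SSet

/-! ### Free `ℤ/2`-spaces and their Stiefel–Whitney class -/

/-- A simplicial set with an involution that is free (on all simplices, hence on the
realization). -/
structure FreeZ2SSet where
  space : SSet.{u}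
  invol : space ⟶ space
  invol_invol : ∀ (Δ) (σ : space.obj Δ), invol.app Δ (invol.app Δ σ) = σ
  free : ∀ (Δ) (σ : space.obj Δ), invol.app Δ σ ≠ σ

namespace FreeZ2SSet

/-- The orbit simplicial set `X / (ℤ/2)`. -/
def quotient (X : FreeZ2SSet.{u}) : SSet.{u} where
  obj Δ := Quot fun σ σ' : X.space.obj Δ => X.invol.app Δ σ = σ'
  map f := ↾(Quot.map (X.space.map f) fun σ σ' h => by
    rw [← h, NatTrans.naturality_apply])
  map_id Δ := by
    ext x
    induction x using Quot.ind
    simp [Quot.map]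
  map_comp f g := by
    ext x
    induction x using Quot.ind
    simp [Quot.map]

/-- An equivariant simplicial map. -/
structure Map (X Y : FreeZ2SSet.{u}) where
  hom : X.space ⟶ Y.space
  equivariant : ∀ (Δ) (σ : X.space.obj Δ),
    hom.app Δ (X.invol.app Δ σ) = Y.invol.app Δ (hom.app Δ σ)

/-- The map `w / (ℤ/2)` of orbit spaces induced by an equivariant map `w`. -/
def Map.quotient {X Y : FreeZ2SSet.{u}} (w : Map X Y) : X.quotient ⟶ Y.quotient where
  app Δ := ↾(Quot.map (w.hom.app Δ) fun σ σ' h => by rw [← h, w.equivariant])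
  naturality Δ Δ' f := by
    ext x
    induction x using Quot.ind
    change Quot.mk _ _ = Quot.mk _ _
    congr 1
    exact NatTrans.naturality_apply w.hom f _

/-- The universal free `ℤ/2`-space `E(ℤ/2)`: an `n`-simplex is an arbitrary sequence of `n + 1`
elements of `ℤ/2`, and the involution adds `1` to all entries. Its nondegenerate simplices are the
alternating sequences, two in each dimension: its realization is `S^∞` with the antipodal action
and its standard cell structure. -/
def EZ2 : FreeZ2SSet.{u} where
  space :=
    { obj := fun Δ => ULift.{u} (Fin (Δ.unop.len + 1) → ZMod 2)
      map := fun f => ↾fun s => ⟨fun i => s.down (f.unop.toOrderHom i)⟩ }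
  invol := { app := fun _ => ↾fun s => ⟨fun i => s.down i + 1⟩ }
  invol_invol Δ s := by
    apply ULift.ext
    funext i
    change s.down i + 1 + 1 = s.down i
    rw [add_assoc, CharTwo.add_self_eq_zero, add_zero]
  free Δ s h := by
    have h1 : s.down 0 + 1 = s.down 0 := congrFun (congrArg ULift.down h) 0
    simp at h1

/-- The classifying space `B(ℤ/2) = E(ℤ/2) / (ℤ/2)`, a model of `ℝP^∞`. -/
abbrev BZ2 : SSet.{u} := EZ2.{u}.quotient

/-- The generator `z` of `H¹(B(ℤ/2); ℤ/2)`: the cocycle with value `a + b` on the orbit of the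
edge `(a, b)`. By the lemmas below it is the
only nonzero 1-cocycle of `B(ℤ/2)`, and it is not a coboundary. -/
def z : SSet.Z2Cochain BZ2.{u} 1 :=
  Quot.lift (fun s : ULift.{u} (Fin 2 → ZMod 2) => s.down 0 + s.down 1) (by
    rintro s _ rfl
    change s.down 0 + s.down 1 = (s.down 0 + 1) + (s.down 1 + 1)
    rw [add_add_add_comm, CharTwo.add_self_eq_zero (1 : ZMod 2), add_zero])

theorem z_mem : z.{u} ∈ SSet.z2Cocycles BZ2.{u} 1 := by
  change SSet.z2d _ _ z = 0
  funext σ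
  induction σ using Quot.ind with
  | mk s =>
    change ∑ i : Fin 3, (s.down (Fin.succAbove i 0) + s.down (Fin.succAbove i 1)) = 0
    rw [Fin.sum_univ_three]
    change (s.down 1 + s.down 2) + (s.down 0 + s.down 2) + (s.down 0 + s.down 1) = 0
    generalize s.down 0 = a
    generalize s.down 1 = b
    generalize s.down 2 = c
    revert a b c
    decide

theorem z_not_mem_coboundaries : z.{u} ∉ SSet.z2Coboundaries BZ2.{u} 1 := by
  rintro ⟨g, hg⟩
  have h1 : ∑ i : Fin 2, g (Quot.mk _ ⟨fun j => (![0, 1] : Fin 2 → ZMod 2) (Fin.succAbove i j)⟩)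
      = 0 + 1 := congrFun hg (Quot.mk _ ⟨![0, 1]⟩)
  have h2 : (Quot.mk _ ⟨fun j => (![0, 1] : Fin 2 → ZMod 2) (Fin.succAbove 1 j)⟩ :
      BZ2.{u}.obj (op (SimplexCategory.mk 0))) =
      Quot.mk _ ⟨fun j => (![0, 1] : Fin 2 → ZMod 2) (Fin.succAbove 0 j)⟩ := by
    apply Quot.sound
    apply ULift.ext
    funext i
    rw [Subsingleton.elim (α := Fin 1) i 0]
    rfl
  rw [Fin.sum_univ_two, h2, CharTwo.add_self_eq_zero] at h1
  exact absurd h1 (by decide)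

theorem cocycle_eq_zero_or_eq_z {f : SSet.Z2Cochain BZ2.{u} 1}
    (hf : f ∈ SSet.z2Cocycles BZ2.{u} 1) : f = 0 ∨ f = z := by
  have h00 : ∀ a : ZMod 2, f (Quot.mk _ ⟨fun _ => a⟩) = 0 := by
    intro a
    have h : ∑ i : Fin 3, f (Quot.mk _ ⟨fun _ => a⟩) = 0 :=
      congrFun (show SSet.z2d _ _ f = 0 from hf) (Quot.mk _ ⟨fun _ => a⟩)
    rw [Fin.sum_univ_three, CharTwo.add_self_eq_zero, zero_add] at h
    exact h
  have key : ∀ σ, f σ = f (Quot.mk _ ⟨![0, 1]⟩) * z σ := by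
    intro σ
    induction σ using Quot.ind with
    | mk s =>
      obtain ⟨s⟩ := s
      change _ = _ * (s 0 + s 1)
      by_cases h : s 0 = s 1
      · have hs : s = fun _ => s 0 := by
          funext i
          fin_cases i
          · rfl
          · exact h.symm
        have hz : s 0 + s 1 = 0 := (congrArg (s 0 + ·) h.symm).trans (CharTwo.add_self_eq_zero _)
        refine Eq.trans ?_ ((congrArg (f (Quot.mk _ ⟨![0, 1]⟩) * ·) hz).trans (mul_zero _)).symm
        exact (congrArg (fun t => f (Quot.mk _ ⟨t⟩)) hs).trans (h00 _)
      · have h1 : s 1 = s 0 + 1 := by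
          revert h
          generalize s 0 = a
          generalize s 1 = b
          revert a b
          decide
        have h2 : (Quot.mk _ ⟨![0, 1]⟩ : BZ2.{u}.obj (op (SimplexCategory.mk 1))) =
            Quot.mk _ ⟨s⟩ := by
          have h3 : s 0 = 0 ∨ s 0 = 1 := by
            generalize s 0 = a
            revert a
            decide
          rcases h3 with h3 | h3
          · congr 2
            funext i
            fin_cases i
            · exact h3.symm
            · exact (by rw [h1, h3]; rfl : (1 : ZMod 2) = s 1)
          · apply Quot.sound
            apply ULift.ext
            funext i
            fin_cases i
            · exact (by rw [h3]; rfl : (0 : ZMod 2) + 1 = s 0)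
            · exact (by rw [h1, h3] : (1 : ZMod 2) + 1 = s 1)
        have hz : s 0 + s 1 = 1 := by
          generalize s 0 = a at h1
          generalize s 1 = b at h1
          revert a b
          decide
        refine Eq.trans ?_ ((congrArg (f (Quot.mk _ ⟨![0, 1]⟩) * ·) hz).trans (mul_one _)).symm
        exact (congrArg f h2).symm
  have h01 : f (Quot.mk _ ⟨![0, 1]⟩) = 0 ∨ f (Quot.mk _ ⟨![0, 1]⟩) = 1 := by
    generalize f (Quot.mk _ ⟨![0, 1]⟩) = a
    revert a
    decide
  rcases h01 with h | h
  · left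
    funext σ
    rw [key σ, h, zero_mul]
    rfl
  · right
    funext σ
    rw [key σ, h, one_mul]

/-- Every free `ℤ/2`-space has an equivariant map to `E(ℤ/2)`. -/
theorem nonempty_map_EZ2 (X : FreeZ2SSet.{u}) : Nonempty (Map X EZ2.{u}) := by
  classical
  let r : X.space.obj (op (SimplexCategory.mk 0)) → X.space.obj (op (SimplexCategory.mk 0)) → Prop :=
    fun σ σ' => X.invol.app _ σ = σ'
  have hr : ∀ a b, Relation.EqvGen r a b → a = b ∨ X.invol.app _ a = b := by
    intro a b h
    induction h with
    | rel a b h => exact Or.inr h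
    | refl a => exact Or.inl rfl
    | symm a b _ ih =>
      rcases ih with rfl | rfl
      · exact Or.inl rfl
      · exact Or.inr (X.invol_invol _ _)
    | trans a b c _ _ ih1 ih2 =>
      rcases ih1 with rfl | rfl
      · exact ih2
      · rcases ih2 with rfl | rfl
        · exact Or.inr rfl
        · exact Or.inl (X.invol_invol _ _).symm
  let c : X.space.obj (op (SimplexCategory.mk 0)) → ZMod 2 :=
    fun σ => if (Quot.mk r σ).out = σ then 0 else 1
  have hc : ∀ σ, c (X.invol.app _ σ) = c σ + 1 := by
    intro σ
    have h0 : Quot.mk r (X.invol.app _ σ) = Quot.mk r σ := (Quot.sound (r := r) rfl).symm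
    simp only [c, h0]
    have h1 := hr _ _ (Quot.eqvGen_exact (Quot.out_eq (Quot.mk r σ)))
    rcases h1 with h1 | h1
    · rw [h1, if_neg (X.free _ σ).symm, if_pos rfl, zero_add]
    · have h2 : (Quot.mk r σ).out = X.invol.app _ σ := by rw [← h1, X.invol_invol, h1]
      rw [if_pos h2, if_neg (by rw [h2]; exact X.free _ σ)]
      decide
  refine ⟨⟨{ app := fun Δ => ↾fun σ => ⟨fun i =>
      c (X.space.map (SimplexCategory.const (SimplexCategory.mk 0) Δ.unop i).op σ)⟩
             naturality := ?_ }, ?_⟩⟩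
  · intro Δ Δ' f
    ext σ
    apply ULift.ext
    funext i
    change c (X.space.map _ (X.space.map f σ)) = c (X.space.map _ σ)
    rw [← Functor.map_comp_apply]
    rfl
  · intro Δ σ
    apply ULift.ext
    funext i
    change c (X.space.map _ (X.invol.app Δ σ)) = c (X.space.map _ σ) + 1
    rw [← NatTrans.naturality_apply, hc]

/-- The cocycle `(w / (ℤ/2))^* z` for an equivariant map `w : X → E(ℤ/2)`. -/
noncomputable def swCocycle (X : FreeZ2SSet.{u}) : SSet.Z2Cochain X.quotient 1 :=
  SSet.z2Pull (Classical.choice X.nonempty_map_EZ2).quotient z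

theorem swCocycle_mem (X : FreeZ2SSet.{u}) : X.swCocycle ∈ SSet.z2Cocycles X.quotient 1 :=
  SSet.z2Pull_mem _ z_mem

/-- The `k`-th power of the Stiefel–Whitney class, `ϖ₁ᵏ(X) ∈ Hᵏ(X / (ℤ/2); ℤ/2)`. -/
noncomputable def swPow (X : FreeZ2SSet.{u}) (k : ℕ) : SSet.Z2Cohomology X.quotient k :=
  Submodule.Quotient.mk ⟨SSet.z2CupPow X.swCocycle k, SSet.z2CupPow_mem X.swCocycle_mem k⟩

/-- `h` is the height of `X`: the largest nonnegative integer with `ϖ₁ʰ(X) ≠ 0`. -/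
def IsHeight (X : FreeZ2SSet.{u}) (h : ℕ) : Prop :=
  IsGreatest {k : ℕ | X.swPow k ≠ 0} h

end FreeZ2SSet

/-! ### Stiefel–Whitney test graphs -/

namespace Z2Graph

variable {V : Type u} {W : Type v}

/-- The `ℤ/2`-space `Hom(T, G)`, for a graph `T` with a `ℤ/2`-action that flips an edge and a
loopless graph `G`, realized by its barycentric subdivision: the nerve of its face poset. -/
def homComplex (T : Z2Graph V) (hT : T.FlipsEdge) (G : LGraph W) (hG : G.Loopless) :
    FreeZ2SSet.{max u v} where
  space := nerve (LGraph.HomCell T.toLGraph G)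
  invol := nerveMap (T.cellInvol_monotone G).functor
  invol_invol _ _ := CategoryTheory.Functor.ext (fun _ => T.cellInvol_cellInvol G _)
    fun _ _ _ => Subsingleton.elim _ _
  free _ _ h := T.cellInvol_ne hT G hG _ (CategoryTheory.Functor.congr_obj h 0)

/-- `h(Hom(T, K_n)) = n - χ(T)`. -/
def IsSWnTestGraph (T : Z2Graph V) (n : ℕ) : Prop :=
  ∃ (hT : T.FlipsEdge) (h : ℕ),
    (T.homComplex hT (LGraph.complete n) (LGraph.complete_loopless n)).IsHeight h ∧
      (h : ℕ∞) + T.chromaticNumber = n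

def IsSWTestGraph (T : Z2Graph V) : Prop :=
  T.FlipsEdge ∧ ∀ n : ℕ, T.chromaticNumber ≤ n → T.IsSWnTestGraph n

end Z2Graph

/-! Composition with a proper equivariant homomorphism `S → T` gives an equivariant map `Hom(T, G) →
Hom(S, G)`, and a Stiefel–Whitney power that vanishes on the target of an equivariant map vanishes
on its source. Hence `Hom(T, Kₙ)` is squeezed between `Hom(B, Kₙ)` and `Hom(A, Kₙ)`, which have the
same height (`IsHeight.of_maps`). A connected bipartite graph with a flipped edge receives an
equivariant homomorphism from `K₂` and has one to `K₂`, so the second claim reduces to the height `n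
- 2` of `Hom(K₂, Kₙ)`, a sphere of dimension `n - 2`.

An equivariant map to `E(ℤ/2)` is an antipodal colouring of the vertices by `ℤ/2`, and the `k`-th
power is represented by the product of the colour differences along a chain (`colorPow`). A prism
homotopy (`sum_colorHomotopy`) makes its class independent of the colouring.

Upper bound: a chain of at least `n` cells of `Hom(K₂, Kₙ)` repeats a cell, so the product is zero.
Lower bound: the cochain is summed over a subdivided hemisphere, whose boundary is a pair of
antipodal hemispheres of one dimension less. The coboundary of a cochain on the quotient therefore
has sum zero. The power has sum one (`hemisphereSum_colorPow`): upstairs it is the coboundary of the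
lower power times the last colour, and the two antipodal values of that product add up to the lower
power, so induction applies. -/

/-! ### Cocycles of colour sequences -/

/-- The product of the differences of consecutive entries of a sequence in `ℤ/2`. -/
def colorPow : (k : ℕ) → (Fin (k + 1) → ZMod 2) → ZMod 2
  | 0, _ => 1
  | k + 1, s => colorPow k (fun i => s i.castSucc) *
      (s (Fin.last k).castSucc + s (Fin.last (k + 1)))

/-- The cochain homotopy between `colorPow` of two sequences. -/
def colorHomotopy : (k : ℕ) → (Fin (k + 1) → ZMod 2) → (Fin (k + 1) → ZMod 2) → ZMod 2
  | 0, c, c' => c 0 + c' 0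
  | k + 1, c, c' =>
      colorHomotopy k (fun i => c i.castSucc) (fun i => c' i.castSucc) *
          (c' (Fin.last k).castSucc + c' (Fin.last (k + 1))) +
        colorPow (k + 1) c * (c (Fin.last (k + 1)) + c' (Fin.last (k + 1)))

theorem colorPow_add_one : ∀ (k : ℕ) (c : Fin (k + 1) → ZMod 2),
    colorPow k (fun i => c i + 1) = colorPow k c
  | 0, _ => rfl
  | k + 1, c => by
    simp only [colorPow]
    rw [colorPow_add_one k (fun i => c i.castSucc), add_add_add_comm,
      CharTwo.add_self_eq_zero (1 : ZMod 2), add_zero]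

theorem colorHomotopy_add_one : ∀ (k : ℕ) (c c' : Fin (k + 1) → ZMod 2),
    colorHomotopy k (fun i => c i + 1) (fun i => c' i + 1) = colorHomotopy k c c'
  | 0, c, c' => by
    simp only [colorHomotopy]
    rw [add_add_add_comm, CharTwo.add_self_eq_zero (1 : ZMod 2), add_zero]
  | k + 1, c, c' => by
    simp only [colorHomotopy]
    rw [colorHomotopy_add_one k (fun i => c i.castSucc), colorPow_add_one,
      add_add_add_comm _ 1, CharTwo.add_self_eq_zero (1 : ZMod 2), add_zero,
      add_add_add_comm _ 1, CharTwo.add_self_eq_zero (1 : ZMod 2), add_zero]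

theorem colorPow_eq_zero : ∀ {k : ℕ} {c : Fin (k + 1) → ZMod 2} (i : Fin k),
    c i.castSucc = c i.succ → colorPow k c = 0
  | 0, _, i, _ => i.elim0
  | k + 1, c, i, h => by
    simp only [colorPow]
    induction i using Fin.lastCases with
    | last =>
      rw [Fin.succ_last] at h
      rw [h, CharTwo.add_self_eq_zero, mul_zero]
    | cast i =>
      rw [colorPow_eq_zero (c := fun i => c i.castSucc) i h, zero_mul]

/-- A prism term survives only if the constant sequence takes no step in it, which leaves the last
term. This yields an explicit primitive of `colorPow (k + 1)`, which is not antipodally invariant.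
-/
theorem colorHomotopy_zero_right : ∀ (k : ℕ) (c : Fin (k + 1) → ZMod 2),
    colorHomotopy k c (fun _ => 0) = colorPow k c * c (Fin.last k)
  | 0, c => by simp [colorHomotopy, colorPow]
  | k + 1, c => by simp [colorHomotopy]

theorem succAbove_castSucc_castSucc {k : ℕ} (i : Fin (k + 2)) (j : Fin (k + 1)) :
    (i.castSucc).succAbove j.castSucc = (i.succAbove j).castSucc := by
  exact Fin.castSucc_succAbove_castSucc

theorem succAbove_castSucc_last {k : ℕ} (i : Fin (k + 1)) :
    (i.castSucc).succAbove (Fin.last k) = Fin.last (k + 1) := by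
  simp [Fin.succAbove, Fin.lt_def]
  omega

/-- The cocycle identity. The faces keeping the last two entries share their last factor, so the
induction hypothesis for the sequence without its last entry sums them; with the other two faces an
identity in `ℤ/2` remains. -/
theorem sum_colorPow : ∀ (k : ℕ) (c : Fin (k + 2) → ZMod 2),
    ∑ i, colorPow k (fun j => c (Fin.succAbove i j)) = 0
  | 0, c => by simp [colorPow]; rfl
  | k + 1, c => by
    have ih := sum_colorPow k (fun i => c i.castSucc)
    rw [Fin.sum_univ_castSucc] at ih
    rw [Fin.sum_univ_castSucc, Fin.sum_univ_castSucc]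
    simp only [colorPow, succAbove_castSucc_castSucc, succAbove_castSucc_last,
      Fin.succAbove_last] at ih ⊢
    rw [← Finset.sum_mul]
    rw [eq_neg_of_add_eq_zero_left ih]
    generalize colorPow k (fun j => c j.castSucc.castSucc) = p
    generalize c (Fin.last k).castSucc.castSucc = x
    generalize c (Fin.last (k + 1)).castSucc = y
    generalize c (Fin.last (k + 2)) = t
    revert p x y t
    decide

/-- Unrolled, `colorHomotopy k c c'` is the sum over `j` of `colorPow (k + 1)` on the prism
simplices `(c 0, …, c j, c' j, …, c' k)`. This is the usual prism identity, proved by recursion on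
the last vertex. -/
theorem sum_colorHomotopy : ∀ (k : ℕ) (c c' : Fin (k + 2) → ZMod 2),
    ∑ i, colorHomotopy k (fun j => c (Fin.succAbove i j)) (fun j => c' (Fin.succAbove i j)) =
      colorPow (k + 1) c + colorPow (k + 1) c'
  | 0, c, c' => by
    simp [colorHomotopy, colorPow, Fin.sum_univ_two]
    ring
  | k + 1, c, c' => by
    have ih := sum_colorHomotopy k (fun i => c i.castSucc) (fun i => c' i.castSucc)
    have hp := sum_colorPow (k + 1) c
    rw [Fin.sum_univ_castSucc] at ih hp
    simp only [Fin.succAbove_last] at hp ih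
    rw [Fin.sum_univ_castSucc]
    have hc : ∀ d : Fin (k + 3) → ZMod 2, colorPow (k + 1 + 1) d =
        colorPow (k + 1) (fun i => d i.castSucc) *
          (d (Fin.last (k + 1)).castSucc + d (Fin.last (k + 1 + 1))) := fun _ => rfl
    rw [hc c, hc c']
    simp only [colorHomotopy, succAbove_castSucc_castSucc, succAbove_castSucc_last,
      Fin.succAbove_last]
    rw [Finset.sum_add_distrib, ← Finset.sum_mul, eq_neg_of_add_eq_zero_left hp,
      Fin.sum_univ_castSucc]
    simp only [succAbove_castSucc_last, Fin.succAbove_last]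
    rw [← Finset.sum_mul, eq_sub_of_add_eq ih]
    generalize colorPow (k + 1) (fun i => c i.castSucc) = p
    generalize colorPow (k + 1) (fun i => c' i.castSucc) = p'
    generalize colorHomotopy k (fun j => c j.castSucc.castSucc) (fun j => c' j.castSucc.castSucc) = q
    generalize c (Fin.last (k + 1)).castSucc = y
    generalize c (Fin.last (k + 1 + 1)) = t
    generalize c' (Fin.last k).castSucc.castSucc = x'
    generalize c' (Fin.last (k + 1)).castSucc = y'
    generalize c' (Fin.last (k + 1 + 1)) = t'
    revert p p' q y t x' y' t'
    decide

/-! ### The powers of the Stiefel–Whitney class and equivariant maps -/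

namespace FreeZ2SSet

theorem z2CupPow_pull {X Y : SSet.{u}} (φ : X ⟶ Y) (f : SSet.Z2Cochain Y 1) (k : ℕ) :
    SSet.z2CupPow (SSet.z2Pull φ f) k = SSet.z2Pull φ (SSet.z2CupPow f k) := by
  induction k with
  | zero => rfl
  | succ k ih =>
    funext σ
    simp only [SSet.z2CupPow, SSet.z2Cup, SSet.z2Pull, ih, NatTrans.naturality_apply]

theorem z2CupPow_z (k : ℕ) (s : ULift.{u} (Fin (k + 1) → ZMod 2)) :
    SSet.z2CupPow z.{u} k (Quot.mk _ s) = colorPow k s.down := by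
  induction k with
  | zero => rfl
  | succ k ih =>
    have h1 := ih ⟨fun i => s.down i.castSucc⟩
    simp only [colorPow, SSet.z2CupPow, SSet.z2Cup]
    rw [← h1]
    congr 1
    change s.down ⟨0 + k, _⟩ + s.down ⟨1 + k, _⟩ = _
    have e : ∀ i j : Fin (k + 2), i = j → s.down i = s.down j := fun _ _ h => congrArg _ h
    exact congrArg₂ (· + ·) (e _ _ (Fin.ext (Nat.zero_add k)))
      (e _ _ (Fin.ext (Nat.add_comm 1 k)))

/-- The colours of the vertices of a simplex under an equivariant map to `E(ℤ/2)`. -/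
def Map.color {X : FreeZ2SSet.{u}} (w : Map X EZ2.{u}) {k : ℕ}
    (σ : X.space.obj (op (SimplexCategory.mk k))) : Fin (k + 1) → ZMod 2 :=
  (w.hom.app _ σ).down

theorem Map.color_δ {X : FreeZ2SSet.{u}} (w : Map X EZ2.{u}) {k : ℕ}
    (σ : X.space.obj (op (SimplexCategory.mk (k + 1)))) (i : Fin (k + 2)) :
    w.color (X.space.δ i σ) = fun j => w.color σ (i.succAbove j) :=
  congrArg ULift.down (SSet.δ_naturality_apply w.hom i σ)

theorem Map.color_invol {X : FreeZ2SSet.{u}} (w : Map X EZ2.{u}) {k : ℕ}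
    (σ : X.space.obj (op (SimplexCategory.mk k))) :
    w.color (X.invol.app _ σ) = fun j => w.color σ j + 1 :=
  congrArg ULift.down (w.equivariant _ σ)

theorem z2CupPow_pull_z {X : FreeZ2SSet.{u}} (w : Map X EZ2.{u}) (k : ℕ)
    (σ : X.space.obj (op (SimplexCategory.mk k))) :
    SSet.z2CupPow (SSet.z2Pull w.quotient z) k (Quot.mk _ σ) = colorPow k (w.color σ) := by
  rw [z2CupPow_pull]
  exact z2CupPow_z k _

/-- The prism homotopy of the two colourings is unchanged when both are shifted by one, so it
descends to the orbit space. -/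
theorem z2CupPow_pull_z_add_mem {X : FreeZ2SSet.{u}} (w w' : Map X EZ2.{u}) (k : ℕ) :
    SSet.z2CupPow (SSet.z2Pull w.quotient z) k + SSet.z2CupPow (SSet.z2Pull w'.quotient z) k ∈
      SSet.z2Coboundaries X.quotient k := by
  cases k with
  | zero =>
    rw [SSet.z2Coboundaries, Submodule.mem_bot]
    funext σ
    exact CharTwo.add_self_eq_zero (1 : ZMod 2)
  | succ k =>
    refine ⟨Quot.lift (fun σ => colorHomotopy k (w.color σ) (w'.color σ)) ?_, ?_⟩
    · rintro σ _ rfl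
      rw [w.color_invol, w'.color_invol, colorHomotopy_add_one]
    · funext σ
      induction σ using Quot.ind with
      | mk σ =>
        refine Eq.trans ?_ (congrArg₂ (· + ·) (z2CupPow_pull_z w (k + 1) σ)
          (z2CupPow_pull_z w' (k + 1) σ)).symm
        refine Eq.trans ?_ (sum_colorHomotopy k (w.color σ) (w'.color σ))
        change ∑ i, colorHomotopy k (w.color (X.space.δ i σ)) (w'.color (X.space.δ i σ)) = _
        simp only [w.color_δ, w'.color_δ]

theorem swPow_eq_zero_iff {X : FreeZ2SSet.{u}} (w : Map X EZ2.{u}) (k : ℕ) :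
    X.swPow k = 0 ↔
      SSet.z2CupPow (SSet.z2Pull w.quotient z) k ∈ SSet.z2Coboundaries X.quotient k := by
  rw [swPow, Submodule.Quotient.mk_eq_zero]
  change SSet.z2CupPow X.swCocycle k ∈ SSet.z2Coboundaries X.quotient k ↔ _
  have h := z2CupPow_pull_z_add_mem w (Classical.choice X.nonempty_map_EZ2) k
  constructor
  · intro h1
    exact (Submodule.add_mem_iff_left _ h1).1 h
  · intro h1
    exact (Submodule.add_mem_iff_right _ h1).1 h

theorem z2Pull_mem_coboundaries {X Y : SSet.{u}} (φ : X ⟶ Y) {k : ℕ} {f : SSet.Z2Cochain Y k}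
    (hf : f ∈ SSet.z2Coboundaries Y k) : SSet.z2Pull φ f ∈ SSet.z2Coboundaries X k := by
  cases k with
  | zero =>
    rw [SSet.z2Coboundaries, Submodule.mem_bot] at hf ⊢
    rw [hf]
    rfl
  | succ k =>
    obtain ⟨g, rfl⟩ := hf
    refine ⟨SSet.z2Pull φ g, ?_⟩
    funext σ
    change ∑ i, g (φ.app _ (X.δ i σ)) = ∑ i, g (Y.δ i (φ.app _ σ))
    exact Finset.sum_congr rfl fun i _ => congrArg g (SSet.δ_naturality_apply φ i σ)

def Map.comp {X Y Z : FreeZ2SSet.{u}} (f : Map X Y) (g : Map Y Z) : Map X Z where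
  hom := f.hom ≫ g.hom
  equivariant Δ σ := by
    change g.hom.app Δ (f.hom.app Δ _) = Z.invol.app Δ (g.hom.app Δ (f.hom.app Δ σ))
    rw [f.equivariant, g.equivariant]

/-- A colouring of `Y` composed with `f` is a colouring of `X`, and by independence of the colouring
it may be used to compute the powers on `X`. -/
theorem swPow_eq_zero_of_map {X Y : FreeZ2SSet.{u}} (f : Map X Y) {k : ℕ} (h : Y.swPow k = 0) :
    X.swPow k = 0 := by
  obtain ⟨w⟩ := Y.nonempty_map_EZ2
  rw [swPow_eq_zero_iff w] at h
  rw [swPow_eq_zero_iff (f.comp w)]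
  have e : SSet.z2CupPow (SSet.z2Pull (f.comp w).quotient z) k =
      SSet.z2Pull f.quotient (SSet.z2CupPow (SSet.z2Pull w.quotient z) k) := by
    funext σ
    induction σ using Quot.ind with
    | mk σ => exact (z2CupPow_pull_z _ k σ).trans (z2CupPow_pull_z w k (f.hom.app _ σ)).symm
  rw [e]
  exact z2Pull_mem_coboundaries _ h

/-- The height is sandwiched along equivariant maps. -/
theorem IsHeight.of_maps {X Y Z : FreeZ2SSet.{u}} (f : Map X Y) (g : Map Y Z) {h : ℕ}
    (hX : X.IsHeight h) (hZ : Z.IsHeight h) : Y.IsHeight h :=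
  ⟨fun h0 => hX.1 (swPow_eq_zero_of_map f h0), fun _ hk => hZ.2 fun h0 =>
    hk (swPow_eq_zero_of_map g h0)⟩

end FreeZ2SSet

/-! ### Functoriality of the complex in the test graph -/

namespace LGraph

variable {U : Type u} {V : Type u} {W : Type v}

/-- The cell `η ∘ φ` for a proper homomorphism `φ`. -/
def Hom.pullCell {S : LGraph U} {T : LGraph V} (φ : Hom S T) (hφ : φ.Proper) (G : LGraph W)
    (η : HomCell T G) : HomCell S G where
  toFun x := η.toFun (φ.toFun x)
  nonempty _ := η.nonempty _
  -- Properness enters here: finitely many large simplices pull back to finitely many because the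
  -- fibres are finite.
  finite := η.finite.preimage' (f := φ.toFun) fun w _ => hφ w
  adj x y h := η.adj _ _ (φ.map_adj x y h)

theorem Hom.pullCell_monotone {S : LGraph U} {T : LGraph V} (φ : Hom S T) (hφ : φ.Proper)
    (G : LGraph W) : Monotone (φ.pullCell hφ G) :=
  fun _ _ h x => h (φ.toFun x)

def Hom.comp {S : LGraph U} {T : LGraph V} {G : LGraph W} (f : Hom S T) (g : Hom T G) :
    Hom S G where
  toFun := g.toFun ∘ f.toFun
  map_adj x y h := g.map_adj _ _ (f.map_adj x y h)

theorem Hom.chromaticNumber_le {S : LGraph U} {T : LGraph V} (f : Hom S T) :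
    S.chromaticNumber ≤ T.chromaticNumber :=
  le_iInf₂ fun n hn => iInf₂_le n (hn.map f.comp)

end LGraph

namespace Z2Graph

variable {U : Type u} {V : Type u} {W : Type v}

/-- The equivariant map `Hom(T, G) → Hom(S, G)` induced by `S → T`. -/
def homComplexMap {S : Z2Graph U} {T : Z2Graph V} (hS : S.FlipsEdge) (hT : T.FlipsEdge)
    (φ : LGraph.Hom S.toLGraph T.toLGraph) (hφ : φ.Proper) (he : Equivariant φ)
    (G : LGraph W) (hG : G.Loopless) :
    FreeZ2SSet.Map (T.homComplex hT G hG) (S.homComplex hS G hG) where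
  hom := nerveMap (φ.pullCell_monotone hφ G).functor
  equivariant _ _ := CategoryTheory.Functor.ext
    (fun _ => LGraph.HomCell.toFun_injective (funext fun x => congrArg _ (he x).symm))
    fun _ _ _ => Subsingleton.elim _ _

theorem FlipsEdge.map {S : Z2Graph U} {T : Z2Graph V} (hS : S.FlipsEdge)
    (φ : LGraph.Hom S.toLGraph T.toLGraph) (he : Equivariant φ) : T.FlipsEdge := by
  obtain ⟨x, y, h, hx, hy⟩ := hS
  exact ⟨φ.toFun x, φ.toFun y, φ.map_adj _ _ h, by rw [← he, hx], by rw [← he, hy]⟩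

theorem IsSWTestGraph.of_factorization {A : Z2Graph U} {T : Z2Graph V} {VB : Type u}
    {B : Z2Graph VB} (hA : A.IsSWTestGraph) (hB : B.IsSWTestGraph)
    (eA : T.chromaticNumber = A.chromaticNumber) (eB : T.chromaticNumber = B.chromaticNumber)
    (φ : LGraph.Hom A.toLGraph T.toLGraph) (hφ : φ.Proper) (hφe : Equivariant φ)
    (ψ : LGraph.Hom T.toLGraph B.toLGraph) (hψ : ψ.Proper) (hψe : Equivariant ψ) :
    T.IsSWTestGraph := by
  have hT : T.FlipsEdge := hA.1.map φ hφe
  refine ⟨hT, fun n hn => ?_⟩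
  obtain ⟨hA1, h, hh, hA2⟩ := hA.2 n (eA ▸ hn)
  obtain ⟨hB1, h', hh', hB2⟩ := hB.2 n (eB ▸ hn)
  rw [← eA] at hA2
  rw [← eB] at hB2
  have e : h' = h := by
    -- The bound by `n` makes the chromatic number finite, so it can be cancelled.
    have hne : T.chromaticNumber ≠ ⊤ := ne_top_of_le_ne_top (ENat.natCast_ne_top n) hn
    lift T.chromaticNumber to ℕ using hne with χ
    norm_cast at hA2 hB2
    omega
  subst e
  exact ⟨hT, h', FreeZ2SSet.IsHeight.of_maps (homComplexMap hT hB1 ψ hψ hψe _ _)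
    (homComplexMap hA1 hT φ hφ hφe _ _) hh' hh, hA2⟩

end Z2Graph

/-! ### Chains in the barycentric subdivision of a sphere -/

/-- The coboundary on functions of sequences. -/
def seqCoboundary {P : Type u} {k : ℕ} (F : (Fin (k + 1) → P) → ZMod 2) :
    (Fin (k + 2) → P) → ZMod 2 :=
  fun s => ∑ i : Fin (k + 2), F (fun j => s (i.succAbove j))

theorem seqCoboundary_snoc {P : Type u} {k : ℕ} (F : (Fin (k + 2) → P) → ZMod 2)
    (s : Fin (k + 2) → P) (x : P) :
    seqCoboundary F (Fin.snoc (α := fun _ => P) s x) =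
      seqCoboundary (fun t : Fin (k + 1) → P => F (Fin.snoc (α := fun _ => P) t x)) s + F s := by
  unfold seqCoboundary
  rw [Fin.sum_univ_castSucc]
  congr 1
  · refine Finset.sum_congr rfl fun i _ => congrArg F (funext fun j => ?_)
    induction j using Fin.lastCases with
    | last => rw [succAbove_castSucc_last, Fin.snoc_last, Fin.snoc_last]
    | cast j => rw [succAbove_castSucc_castSucc, Fin.snoc_castSucc, Fin.snoc_castSucc]
  · refine congrArg F (funext fun j => ?_)
    rw [Fin.succAbove_last, Fin.snoc_castSucc]

/-- The bottom degree is separate: fixing the last entry would leave a function of the empty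
sequence. -/
theorem seqCoboundary_snoc_zero {P : Type u} (F : (Fin 1 → P) → ZMod 2)
    (s : Fin 1 → P) (x : P) :
    seqCoboundary F (Fin.snoc (α := fun _ => P) s x) = F (fun _ => x) + F s := by
  unfold seqCoboundary
  rw [Fin.sum_univ_two]
  have h : ∀ j : Fin 1, j = 0 := fun j => Subsingleton.elim j 0
  congr 2
  all_goals
    funext j
    rw [h j]
    rfl

/-! ### Flags in a single cell -/

/-- A coordinate together with a sign. -/
abbrev SignedPoint : Type := ℕ × ZMod 2

/-- The mod 2 boundary, dually: the sum of `Φ` over the facets of `C`. -/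
def facetSum (Φ : Finset SignedPoint → ZMod 2) (C : Finset SignedPoint) : ZMod 2 :=
  ∑ x ∈ C, Φ (C.erase x)

theorem facetSum_facetSum (Φ : Finset SignedPoint → ZMod 2) (C : Finset SignedPoint) :
    facetSum (facetSum Φ) C = 0 := by
  unfold facetSum
  rw [Finset.sum_sigma']
  refine Finset.sum_involution (fun p _ => ⟨p.2, p.1⟩) ?_ ?_ ?_ ?_
  · rintro ⟨x, y⟩ _
    rw [Finset.erase_right_comm, CharTwo.add_self_eq_zero]
  · rintro ⟨x, y⟩ h _ he
    simp only [Finset.mem_sigma, Finset.mem_erase] at h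
    exact h.2.1 (congrArg Sigma.fst he)
  · rintro ⟨x, y⟩ h
    simp only [Finset.mem_sigma, Finset.mem_erase] at h ⊢
    exact ⟨h.2.2, h.2.1.symm, h.1⟩
  · rintro ⟨x, y⟩ _
    rfl

/-- The sum of the signs. -/
def signSum (C : Finset SignedPoint) : ZMod 2 := ∑ x ∈ C, x.2

/-- Each point of a triple lies in two of its three pairs, so its sign is counted twice.
Geometrically, an edge has two end points: the number of pairs of mixed sign in a triple is even. -/
theorem facetSum_signSum {C : Finset SignedPoint} (hC : C.card = 3) : facetSum signSum C = 0 := by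
  unfold facetSum signSum
  have h : ∀ x ∈ C, ∑ y ∈ C.erase x, y.2 = ∑ y ∈ C, y.2 - x.2 := fun x hx => by
    rw [← Finset.add_sum_erase C (fun y => y.2) hx]; ring
  rw [Finset.sum_congr rfl h, Finset.sum_sub_distrib, Finset.sum_const, hC]
  generalize ∑ y ∈ C, y.2 = a
  revert a
  decide

/-- The sum of `F` over the top simplices of the barycentric subdivision of the cell `C`, a product
of two simplices with `k + 2` vertices in total, separated by their signs. -/
def sdSum : (k : ℕ) → Finset SignedPoint → ((Fin (k + 1) → Finset SignedPoint) → ZMod 2) → ZMod 2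
  | 0, C, F => signSum C * F (fun _ => C)
  | k + 1, C, F => ∑ x ∈ C, sdSum k (C.erase x)
      (fun s => F (Fin.snoc (α := fun _ => Finset SignedPoint) s C))

theorem sdSum_add : ∀ (k : ℕ) (C : Finset SignedPoint)
    (F G : (Fin (k + 1) → Finset SignedPoint) → ZMod 2),
    sdSum k C (fun s => F s + G s) = sdSum k C F + sdSum k C G
  | 0, _, _, _ => mul_add _ _ _
  | k + 1, C, F, G => by
    simp only [sdSum]
    rw [← Finset.sum_add_distrib]
    exact Finset.sum_congr rfl fun x _ => sdSum_add k _ _ _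

/-- Only flags that end at `C` and lose one point per step are summed, and the weight at the bottom
discards those with zero sign sum. When `C` has `k + 2` points the bottom is a pair of opposite
signs. -/
theorem sdSum_congr : ∀ (k : ℕ) (C : Finset SignedPoint)
    (F G : (Fin (k + 1) → Finset SignedPoint) → ZMod 2),
    (∀ s, Monotone s → s (Fin.last k) = C → (s 0).card + k = C.card → signSum (s 0) ≠ 0 →
      F s = G s) → sdSum k C F = sdSum k C G
  | 0, C, F, G, h => by
    simp only [sdSum]
    by_cases h0 : signSum C = 0
    · rw [h0, zero_mul, zero_mul]
    · rw [h (fun _ => C) monotone_const rfl rfl h0]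
  | k + 1, C, F, G, h => by
    simp only [sdSum]
    refine Finset.sum_congr rfl fun x hx => sdSum_congr k _ _ _ fun s hs hl hc h0 => ?_
    have e : (Fin.snoc (α := fun _ => Finset SignedPoint) s C : Fin (k + 2) → _) 0 = s 0 :=
      Fin.snoc_castSucc (α := fun _ => Finset SignedPoint) C s 0
    refine h _ ?_ (Fin.snoc_last _ _) ?_ (by rwa [e])
    · rw [Fin.monotone_iff_le_succ]
      intro i
      induction i using Fin.lastCases with
      | last =>
        rw [Fin.snoc_castSucc, Fin.succ_last, Fin.snoc_last, hl]
        exact Finset.erase_subset _ _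
      | cast i =>
        rw [Fin.snoc_castSucc, Fin.succ_castSucc, Fin.snoc_castSucc]
        exact hs (Fin.castSucc_lt_succ).le
    · rw [e]
      rw [Finset.card_erase_of_mem hx] at hc
      have := Finset.card_pos.2 ⟨x, hx⟩
      omega

/-- Dually: the boundary of the subdivided cell is the subdivision of the boundary. -/
theorem sdSum_seqCoboundary : ∀ (k : ℕ) (C : Finset SignedPoint), C.card = k + 3 →
    ∀ F : (Fin (k + 1) → Finset SignedPoint) → ZMod 2,
    sdSum (k + 1) C (seqCoboundary F) = facetSum (fun D => sdSum k D F) C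
  | 0, C, hC, F => by
    rw [sdSum]
    simp only [seqCoboundary_snoc_zero]
    simp only [sdSum_add, Finset.sum_add_distrib]
    have h : ∑ x ∈ C, sdSum 0 (C.erase x) (fun _ => F fun _ => C) = 0 := by
      simp only [sdSum]
      rw [← Finset.sum_mul]
      exact (congrArg (· * _) (facetSum_signSum hC)).trans (zero_mul _)
    rw [h, zero_add]
    rfl
  | k + 1, C, hC, F => by
    rw [sdSum]
    simp only [seqCoboundary_snoc]
    simp only [sdSum_add, Finset.sum_add_distrib]
    -- The faces keeping the top `C` add up, by induction, to an iterated facet sum, which is zero;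
    -- the face dropping `C` gives the right-hand side.
    have h : ∑ x ∈ C, sdSum (k + 1) (C.erase x) (seqCoboundary fun t =>
        F (Fin.snoc (α := fun _ => Finset SignedPoint) t C)) = 0 := by
      rw [← facetSum_facetSum (fun D => sdSum k D fun t =>
        F (Fin.snoc (α := fun _ => Finset SignedPoint) t C)) C]
      refine Finset.sum_congr rfl fun x hx => sdSum_seqCoboundary k _ ?_ _
      rw [Finset.card_erase_of_mem hx, hC]
      rfl
    rw [h, zero_add]
    rfl

/-- The change of the sign of a point. -/
def pointFlip : SignedPoint ↪ SignedPoint where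
  toFun x := (x.1, x.2 + 1)
  inj' x y h := by
    have h' := Prod.mk.inj h
    exact Prod.ext h'.1 (add_right_cancel h'.2)

theorem pointFlip_apply (x : SignedPoint) : pointFlip x = (x.1, x.2 + 1) := rfl

/-- The antipodal map. -/
def signFlip (C : Finset SignedPoint) : Finset SignedPoint :=
  C.map pointFlip

theorem mem_signFlip {C : Finset SignedPoint} {i : ℕ} {a : ZMod 2} :
    (i, a) ∈ signFlip C ↔ (i, a + 1) ∈ C := by
  unfold signFlip
  simp only [Finset.mem_map, pointFlip_apply, Prod.exists, Prod.mk.injEq]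
  constructor
  · rintro ⟨j, b, h, rfl, rfl⟩
    rwa [add_assoc, CharTwo.add_self_eq_zero, add_zero]
  · intro h
    exact ⟨i, a + 1, h, rfl, by rw [add_assoc, CharTwo.add_self_eq_zero, add_zero]⟩

theorem signFlip_insert (C : Finset SignedPoint) (i : ℕ) (a : ZMod 2) :
    signFlip (insert (i, a) C) = insert (i, a + 1) (signFlip C) :=
  Finset.map_insert _ _ _

theorem sdSum_signFlip : ∀ (k : ℕ) (C : Finset SignedPoint), C.card = k + 2 →
    ∀ F : (Fin (k + 1) → Finset SignedPoint) → ZMod 2,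
    sdSum k (signFlip C) F = sdSum k C (fun s => F (fun i => signFlip (s i)))
  | 0, C, hC, F => by
    simp only [sdSum]
    congr 1
    unfold signSum signFlip
    rw [Finset.sum_map]
    simp only [pointFlip_apply]
    rw [Finset.sum_add_distrib, Finset.sum_const, hC]
    exact add_zero _
  | k + 1, C, hC, F => by
    simp only [sdSum]
    rw [signFlip, Finset.sum_map]
    refine Finset.sum_congr rfl fun x hx => ?_
    rw [← Finset.map_erase, ← signFlip, ← signFlip, sdSum_signFlip k _ (by
      rw [Finset.card_erase_of_mem hx, hC]; rfl)]
    refine congrArg _ (funext fun s => congrArg F (funext fun i => ?_))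
    induction i using Fin.lastCases with
    | last => rw [Fin.snoc_last, Fin.snoc_last]
    | cast i => rw [Fin.snoc_castSucc, Fin.snoc_castSucc]

/-! ### The sphere and its hemispheres -/

/-- The sum of `Φ` over the graphs of all functions `{0, …, m - 1} → ℤ/2`. -/
def signSphereSum : ℕ → (Finset SignedPoint → ZMod 2) → ZMod 2
  | 0, Φ => Φ ∅
  | m + 1, Φ => signSphereSum m (fun C => Φ (insert (m, 0) C)) +
      signSphereSum m (fun C => Φ (insert (m, 1) C))

/-- `C` is the graph of a function `{0, …, m - 1} → ℤ/2`. -/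
def IsSignGraph (m : ℕ) (C : Finset SignedPoint) : Prop :=
  C.card = m ∧ (∀ x ∈ C, x.1 < m) ∧ ∀ i, ¬ ((i, 0) ∈ C ∧ (i, 1) ∈ C)

theorem IsSignGraph.not_mem {m : ℕ} {C : Finset SignedPoint} (h : IsSignGraph m C) (a : ZMod 2) :
    (m, a) ∉ C := fun ha => lt_irrefl _ (h.2.1 _ ha)

theorem IsSignGraph.insert {m : ℕ} {C : Finset SignedPoint} (h : IsSignGraph m C) (a : ZMod 2) :
    IsSignGraph (m + 1) (insert (m, a) C) := by
  refine ⟨by rw [Finset.card_insert_of_notMem (h.not_mem a), h.1], fun x hx => ?_, fun i hi => ?_⟩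
  · rcases Finset.mem_insert.1 hx with rfl | hx
    · exact Nat.lt_succ_self _
    · exact (h.2.1 x hx).trans (Nat.lt_succ_self _)
  · rcases Finset.mem_insert.1 hi.1 with h0 | h0 <;> rcases Finset.mem_insert.1 hi.2 with h1 | h1
    · exact absurd ((congrArg Prod.snd h0).trans (congrArg Prod.snd h1).symm) (by simp)
    · exact h.not_mem 1 ((Prod.mk.inj h0).1 ▸ h1)
    · exact h.not_mem 0 ((Prod.mk.inj h1).1 ▸ h0)
    · exact h.2.2 i ⟨h0, h1⟩

theorem signSphereSum_congr : ∀ (m : ℕ) (Φ Ψ : Finset SignedPoint → ZMod 2),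
    (∀ C, IsSignGraph m C → Φ C = Ψ C) → signSphereSum m Φ = signSphereSum m Ψ
  | 0, _, _, h => h ∅ ⟨rfl, by simp, by simp⟩
  | m + 1, Φ, Ψ, h => by
    simp only [signSphereSum]
    congr 1 <;> exact signSphereSum_congr m _ _ fun C hC => h _ (hC.insert _)

theorem signSphereSum_add : ∀ (m : ℕ) (Φ Ψ : Finset SignedPoint → ZMod 2),
    signSphereSum m (fun C => Φ C + Ψ C) = signSphereSum m Φ + signSphereSum m Ψ
  | 0, _, _ => rfl
  | m + 1, Φ, Ψ => by
    simp only [signSphereSum]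
    rw [signSphereSum_add m, signSphereSum_add m, add_add_add_comm]

theorem facetSum_insert {Φ : Finset SignedPoint → ZMod 2} {C : Finset SignedPoint}
    {x : SignedPoint} (hx : x ∉ C) :
    facetSum Φ (insert x C) = Φ C + facetSum (fun D => Φ (insert x D)) C := by
  unfold facetSum
  rw [Finset.sum_insert hx, Finset.erase_insert hx]
  congr 1
  refine Finset.sum_congr rfl fun y hy => ?_
  rw [Finset.erase_insert_of_ne]
  rintro rfl
  exact hx hy

theorem signSphereSum_facetSum_insert {m : ℕ} (a : ZMod 2) (Φ : Finset SignedPoint → ZMod 2) :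
    signSphereSum m (fun C => facetSum Φ (insert (m, a) C)) =
      signSphereSum m Φ + signSphereSum m (facetSum fun D => Φ (insert (m, a) D)) := by
  rw [← signSphereSum_add]
  exact signSphereSum_congr m _ _ fun C hC => facetSum_insert (hC.not_mem a)

/-- The sphere is a cycle. -/
theorem signSphereSum_facetSum : ∀ (m : ℕ) (Φ : Finset SignedPoint → ZMod 2),
    signSphereSum m (facetSum Φ) = 0
  | 0, _ => rfl
  | m + 1, Φ => by
    -- A facet omitting the last coordinate occurs twice, once for each sign of that coordinate.
    rw [signSphereSum, signSphereSum_facetSum_insert, signSphereSum_facetSum_insert,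
      signSphereSum_facetSum m, signSphereSum_facetSum m, add_zero, CharTwo.add_self_eq_zero]

theorem signSphereSum_signFlip : ∀ (m : ℕ) (Φ : Finset SignedPoint → ZMod 2),
    signSphereSum m (fun C => Φ (signFlip C)) = signSphereSum m Φ
  | 0, _ => rfl
  | m + 1, Φ => by
    simp only [signSphereSum, signFlip_insert]
    rw [signSphereSum_signFlip m (fun C => Φ (insert (m, 0 + 1) C)),
      signSphereSum_signFlip m (fun C => Φ (insert (m, 1 + 1) C)), add_comm]
    rfl

/-- The sum of `F` over the subdivision of a hemisphere of dimension `k`. -/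
def hemisphereSum (k : ℕ) (F : (Fin (k + 1) → Finset SignedPoint) → ZMod 2) : ZMod 2 :=
  signSphereSum (k + 1) (fun C => sdSum k (insert (k + 1, 0) C) F)

theorem hemisphereSum_add (k : ℕ) (F G : (Fin (k + 1) → Finset SignedPoint) → ZMod 2) :
    hemisphereSum k (fun s => F s + G s) = hemisphereSum k F + hemisphereSum k G := by
  simp only [hemisphereSum, sdSum_add, signSphereSum_add]

/-- The boundary of a hemisphere consists of two hemispheres. -/
theorem hemisphereSum_seqCoboundary (k : ℕ)
    (F : (Fin (k + 1) → Finset SignedPoint) → ZMod 2) :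
    hemisphereSum (k + 1) (seqCoboundary F) =
      hemisphereSum k F + hemisphereSum k (fun s => F (fun i => signFlip (s i))) := by
  unfold hemisphereSum
  rw [signSphereSum_congr (k + 1 + 1) _ _ fun C hC =>
    sdSum_seqCoboundary k (insert (k + 1 + 1, 0) C) (hC.insert 0).1 F]
  -- The facets through the apex `(k + 2, 0)` cancel because the base sphere is a cycle. What
  -- remains is the base, split by the sign of its last coordinate; the negative half is the
  -- antipode of the positive one.
  rw [signSphereSum_facetSum_insert, signSphereSum_facetSum, add_zero, signSphereSum]
  congr 1
  rw [← signSphereSum_signFlip]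
  refine signSphereSum_congr _ _ _ fun C hC => ?_
  rw [← sdSum_signFlip k _ (hC.insert 0).1, signFlip_insert]
  rfl

/-- The cells of the sphere with coordinates less than `n`. -/
def IsSignCell (n : ℕ) (C : Finset SignedPoint) : Prop :=
  (∀ a : ZMod 2, ∃ i, (i, a) ∈ C) ∧ (∀ x ∈ C, x.1 < n) ∧ ∀ i, ¬ ((i, 0) ∈ C ∧ (i, 1) ∈ C)

theorem IsSignCell.signFlip {n : ℕ} {C : Finset SignedPoint} (h : IsSignCell n C) :
    IsSignCell n (signFlip C) := by
  refine ⟨fun a => ?_, fun x hx => ?_, fun i hi => ?_⟩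
  · obtain ⟨i, hi⟩ := h.1 (a + 1)
    exact ⟨i, mem_signFlip.2 hi⟩
  · exact h.2.1 (x.1, x.2 + 1) (mem_signFlip.1 hx)
  · exact h.2.2 i ⟨mem_signFlip.1 hi.2, mem_signFlip.1 hi.1⟩

theorem exists_sign_of_signSum_ne_zero {C : Finset SignedPoint} (hC : C.card = 2)
    (h : signSum C ≠ 0) (a : ZMod 2) : ∃ i, (i, a) ∈ C := by
  obtain ⟨⟨i, b⟩, ⟨j, c⟩, hne, rfl⟩ := Finset.card_eq_two.1 hC
  rw [signSum, Finset.sum_pair hne] at h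
  have h1 : a = b ∨ a = c := by
    clear hne hC
    simp only at h
    revert a b c
    decide
  rcases h1 with rfl | rfl
  · exact ⟨i, by simp⟩
  · exact ⟨j, by simp⟩

/-- Every member of a counted flag contains its bottom pair, so both signs occur in it, and it lies
in a sign graph on `k + 2 ≤ n` coordinates. Hence only chains of genuine cells matter. -/
theorem hemisphereSum_congr {k n : ℕ} (hk : k + 2 ≤ n)
    {F G : (Fin (k + 1) → Finset SignedPoint) → ZMod 2}
    (h : ∀ s, Monotone s → (∀ i, IsSignCell n (s i)) → F s = G s) :
    hemisphereSum k F = hemisphereSum k G := by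
  refine signSphereSum_congr _ _ _ fun C hC => sdSum_congr _ _ _ _ fun s hs hl hc h0 => ?_
  have hC' := hC.insert 0
  rw [hC'.1] at hc
  refine h s hs fun i => ?_
  have hi : s i ⊆ insert (k + 1, 0) C := hl ▸ hs (Fin.le_last i)
  refine ⟨fun a => ?_, fun x hx => (hC'.2.1 x (hi hx)).trans_le hk, fun j hj =>
    hC'.2.2 j ⟨hi hj.1, hi hj.2⟩⟩
  obtain ⟨j, hj⟩ := exists_sign_of_signSum_ne_zero (by omega) h0 a
  exact ⟨j, hs (Fin.zero_le i) hj⟩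

/-- For an antipodal colouring of the cells, the power of its coboundary has value one on the
hemisphere. -/
theorem hemisphereSum_colorPow {n : ℕ} (c : Finset SignedPoint → ZMod 2)
    (hc : ∀ C, IsSignCell n C → c (signFlip C) = c C + 1) :
    ∀ k : ℕ, k + 2 ≤ n → hemisphereSum k (fun s => colorPow k (fun i => c (s i))) = 1
  | 0, _ => by
    -- Of the two pairs containing `(1, 0)`, only the one with `(0, 1)` has mixed signs.
    simp only [hemisphereSum, signSphereSum, sdSum, colorPow, signSum]
    decide
  | k + 1, hk => by
    -- Comparison with the constant colouring, which is not antipodal, makes the power a coboundary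
    -- before passing to orbits.
    have h : (fun s : Fin (k + 2) → Finset SignedPoint => colorPow (k + 1) (fun i => c (s i))) =
        seqCoboundary fun s => colorHomotopy k (fun i => c (s i)) (fun _ => 0) := by
      funext s
      rw [seqCoboundary, sum_colorHomotopy k (fun i => c (s i)) (fun _ => 0),
        colorPow_eq_zero (c := fun _ => 0) 0 rfl, add_zero]
    rw [h, hemisphereSum_seqCoboundary, ← hemisphereSum_add,
      ← hemisphereSum_colorPow c hc k (by omega)]
    refine hemisphereSum_congr (n := n) (by omega) fun s _ hs => ?_
    -- At the antipode the lower power is unchanged and the last colour grows by one, so the two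
    -- values add up to the lower power.
    simp only [fun i => hc _ (hs i), colorHomotopy_zero_right]
    rw [colorPow_add_one k (fun i => c (s i)), ← mul_add, ← add_assoc,
      CharTwo.add_self_eq_zero, zero_add, mul_one]

/-! ### The complex of homomorphisms from an edge to a complete graph -/

theorem zmod_two_eq_zero_or_one : ∀ a : ZMod 2, a = 0 ∨ a = 1 := by decide

namespace Z2Graph

/-- The complete graph on two vertices with the involution that flips the edge. -/
def edge : Z2Graph (ULift.{u} (ZMod 2)) where
  Adj x y := y.down = x.down + 1
  symm x y h := by rw [h, add_assoc, CharTwo.add_self_eq_zero, add_zero]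
  invol x := ⟨x.down + 1⟩
  invol_invol x := ULift.ext _ _ (by
    change x.down + 1 + 1 = x.down
    rw [add_assoc, CharTwo.add_self_eq_zero, add_zero])
  invol_adj x y h := congrArg (· + 1) h

theorem edge_flipsEdge : edge.{u}.FlipsEdge :=
  ⟨⟨0⟩, ⟨1⟩, rfl, rfl, rfl⟩

theorem edge_chromaticNumber : edge.{u}.chromaticNumber = 2 := by
  apply le_antisymm
  · refine iInf₂_le 2 ⟨⟨fun x => x.down, fun x y h => ?_⟩⟩
    change x.down ≠ y.down
    rw [show y.down = x.down + 1 from h]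
    generalize x.down = a
    revert a
    decide
  · refine le_iInf₂ fun n ⟨f⟩ => ?_
    have h : f.toFun ⟨0⟩ ≠ f.toFun ⟨1⟩ := f.map_adj ⟨0⟩ ⟨1⟩ rfl
    have h1 : 1 < n := by
      by_contra hn
      have := Fin.subsingleton_iff_le_one.2 (not_lt.1 hn)
      exact h (Subsingleton.elim _ _)
    exact_mod_cast h1

/-- The complex `Hom(K₂, Kₙ)`. -/
noncomputable abbrev edgeComplex (n : ℕ) : FreeZ2SSet.{u} :=
  edge.{u}.homComplex edge_flipsEdge (LGraph.complete n) (LGraph.complete_loopless n)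

abbrev EdgeCell (n : ℕ) : Type u := LGraph.HomCell edge.{u}.toLGraph (LGraph.complete n)

/-! ### Upper bound for the height of `Hom(K₂, Kₙ)` -/

/-- The number of vertices of the two simplices of a cell. -/
def edgeCellSize {n : ℕ} (η : EdgeCell.{u} n) : ℕ :=
  (η.toFun ⟨0⟩).card + (η.toFun ⟨1⟩).card

theorem two_le_edgeCellSize {n : ℕ} (η : EdgeCell.{u} n) : 2 ≤ edgeCellSize η := by
  have h0 := (η.nonempty ⟨0⟩).card_pos
  have h1 := (η.nonempty ⟨1⟩).card_pos
  unfold edgeCellSize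
  omega

theorem edgeCellSize_le {n : ℕ} (η : EdgeCell.{u} n) : edgeCellSize η ≤ n := by
  unfold edgeCellSize
  rw [← Finset.card_union_of_disjoint]
  · exact (Finset.card_le_univ _).trans (Fintype.card_fin n).le
  · exact Finset.disjoint_left.2 fun a h0 h1 => η.adj ⟨0⟩ ⟨1⟩ rfl a h0 a h1 rfl

theorem edgeCellSize_strictMono {n : ℕ} : StrictMono (edgeCellSize : EdgeCell.{u} n → ℕ) := by
  intro η θ h
  have hle : ∀ x, η.toFun x ⊆ θ.toFun x := h.le
  have h0 := Finset.card_le_card (hle ⟨0⟩)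
  have h1 := Finset.card_le_card (hle ⟨1⟩)
  by_contra hn
  unfold edgeCellSize at hn
  refine h.ne (LGraph.HomCell.toFun_injective (funext fun x => ?_))
  obtain ⟨x⟩ := x
  rcases zmod_two_eq_zero_or_one x with rfl | rfl
  · exact Finset.eq_of_subset_of_card_le (hle _) (by omega)
  · exact Finset.eq_of_subset_of_card_le (hle _) (by omega)

/-- The colour of a cell under an equivariant map to `E(ℤ/2)`. -/
noncomputable def edgeCellColor {n : ℕ} (w : FreeZ2SSet.Map (edgeComplex.{u} n) FreeZ2SSet.EZ2)
    (η : EdgeCell.{u} n) : ZMod 2 :=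
  w.color (X := edgeComplex.{u} n) (k := 0) (monotone_const (c := η)).functor 0

theorem color_eq_edgeCellColor {n : ℕ}
    (w : FreeZ2SSet.Map (edgeComplex.{u} n) FreeZ2SSet.EZ2) {k : ℕ}
    (σ : (edgeComplex.{u} n).space.obj (op (SimplexCategory.mk k))) (i : Fin (k + 1)) :
    w.color σ i = edgeCellColor w
      (CategoryTheory.Functor.obj (show Fin (k + 1) ⥤ EdgeCell.{u} n from σ) i) := by
  have h := congrArg ULift.down (NatTrans.naturality_apply w.hom
    (SimplexCategory.const (SimplexCategory.mk 0) (SimplexCategory.mk k) i).op σ)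
  exact (congrFun h 0).symm

theorem edgeCellColor_invol {n : ℕ}
    (w : FreeZ2SSet.Map (edgeComplex.{u} n) FreeZ2SSet.EZ2) (η : EdgeCell.{u} n) :
    edgeCellColor w (edge.cellInvol _ η) = edgeCellColor w η + 1 :=
  congrFun (w.color_invol (k := 0)
    (monotone_const (c := η)).functor) 0

/-- The Stiefel–Whitney class of `Hom(K₂, Kₙ)` has no power above the dimension. -/
theorem swPow_edgeComplex_eq_zero {n k : ℕ} (hk : n ≤ k + 1) :
    (edgeComplex.{u} n).swPow k = 0 := by
  obtain ⟨w⟩ := (edgeComplex.{u} n).nonempty_map_EZ2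
  rw [FreeZ2SSet.swPow_eq_zero_iff w]
  suffices h : SSet.z2CupPow (SSet.z2Pull w.quotient FreeZ2SSet.z) k = 0 by
    rw [h]
    exact Submodule.zero_mem _
  funext σ
  induction σ using Quot.ind with
  | mk σ =>
    refine (FreeZ2SSet.z2CupPow_pull_z w k σ).trans ?_
    let F : Fin (k + 1) ⥤ EdgeCell.{u} n := σ
    -- Without a repetition the sizes would rise strictly from at least `2` to at least `k + 2 > n`.
    have hF : ∃ i : Fin k, F.obj i.castSucc = F.obj i.succ := by
      by_contra hne
      push Not at hne
      have hs : StrictMono (fun i => edgeCellSize (F.obj i)) := by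
        rw [Fin.strictMono_iff_lt_succ]
        intro i
        exact edgeCellSize_strictMono (lt_of_le_of_ne
          (leOfHom (F.map (homOfLE (Fin.castSucc_lt_succ (i := i)).le))) (hne i))
      have hc : ∀ i : Fin (k + 1), 2 + i.1 ≤ edgeCellSize (F.obj i) := by
        intro i
        induction i using Fin.induction with
        | zero => exact two_le_edgeCellSize _
        | succ i ih => exact Nat.succ_le_of_lt (ih.trans_lt (hs Fin.castSucc_lt_succ))
      have h1 := hc (Fin.last k)
      have h2 := edgeCellSize_le (F.obj (Fin.last k))
      rw [Fin.val_last] at h1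
      omega
    obtain ⟨i, hi⟩ := hF
    refine colorPow_eq_zero i ?_
    rw [color_eq_edgeCellColor, color_eq_edgeCellColor]
    exact congrArg _ hi

/-! ### Lower bound for the height of `Hom(K₂, Kₙ)` -/

open Classical in
/-- The cell of `Hom(K₂, Kₙ)` given by a set of signed points. -/
noncomputable def toEdgeCell (n : ℕ) (hn : 2 ≤ n) (C : Finset SignedPoint) : EdgeCell.{u} n :=
  if h : IsSignCell n C then
    { toFun := fun x => Finset.univ.filter fun i : Fin n => (i.1, x.down) ∈ C
      nonempty := fun x => by
        obtain ⟨i, hi⟩ := h.1 x.down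
        exact ⟨⟨i, h.2.1 _ hi⟩, by simpa using hi⟩
      finite := Set.toFinite _
      adj := fun x y hxy a ha b hb hab => by
        subst hab
        have hy : y.down = x.down + 1 := hxy
        simp only [Finset.mem_filter, Finset.mem_univ, true_and] at ha hb
        rw [hy] at hb
        generalize x.down = c at ha hb
        rcases zmod_two_eq_zero_or_one c with rfl | rfl
        · exact h.2.2 a.1 ⟨ha, hb⟩
        · exact h.2.2 a.1 ⟨hb, ha⟩ }
  else
    -- An arbitrary default, the vertex `(0, 1)` of the complex; it also shows that the complex is
    -- nonempty.
    { toFun := fun x => {if x.down = 0 then (⟨0, by omega⟩ : Fin n) else ⟨1, by omega⟩}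
      nonempty := fun x => Finset.singleton_nonempty _
      finite := Set.toFinite _
      adj := fun x y hxy a ha b hb hab => by
        subst hab
        have hy : y.down = x.down + 1 := hxy
        rw [Finset.mem_singleton] at ha hb
        rw [ha, hy] at hb
        generalize x.down = c at hb
        rcases zmod_two_eq_zero_or_one c with rfl | rfl <;> simp [Fin.ext_iff, CharTwo.add_self_eq_zero] at hb }

theorem mem_toEdgeCell {n : ℕ} (hn : 2 ≤ n) {C : Finset SignedPoint} (h : IsSignCell n C)
    (x : ULift.{u} (ZMod 2)) (i : Fin n) :
    i ∈ (toEdgeCell.{u} n hn C).toFun x ↔ (i.1, x.down) ∈ C := by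
  rw [toEdgeCell, dif_pos h]
  simp

theorem toEdgeCell_le {n : ℕ} (hn : 2 ≤ n) {C D : Finset SignedPoint} (hC : IsSignCell n C)
    (hD : IsSignCell n D) (h : C ⊆ D) : toEdgeCell.{u} n hn C ≤ toEdgeCell n hn D :=
  fun x i hi => (mem_toEdgeCell hn hD x i).2 (h ((mem_toEdgeCell hn hC x i).1 hi))

theorem toEdgeCell_signFlip {n : ℕ} (hn : 2 ≤ n) {C : Finset SignedPoint}
    (hC : IsSignCell n C) :
    toEdgeCell.{u} n hn (signFlip C) = edge.cellInvol _ (toEdgeCell n hn C) := by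
  refine LGraph.HomCell.toFun_injective (funext fun x => Finset.ext fun i => ?_)
  refine (mem_toEdgeCell hn hC.signFlip x i).trans (mem_signFlip.trans ?_)
  exact (mem_toEdgeCell hn hC (edge.invol x) i).symm

open Classical in
/-- The value of a cochain on the orbit of a sequence of cells, zero if this is not a chain. -/
noncomputable def seqCochain {n k : ℕ} (hn : 2 ≤ n)
    (g : SSet.Z2Cochain (edgeComplex.{u} n).quotient k)
    (s : Fin (k + 1) → Finset SignedPoint) : ZMod 2 :=
  if h : Monotone (fun i => toEdgeCell.{u} n hn (s i)) then g (Quot.mk _ h.functor) else 0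

theorem monotone_toEdgeCell {n k : ℕ} (hn : 2 ≤ n) {s : Fin (k + 1) → Finset SignedPoint}
    (hs : Monotone s) (hs' : ∀ i, IsSignCell n (s i)) :
    Monotone (fun i => toEdgeCell.{u} n hn (s i)) :=
  fun i j h => toEdgeCell_le hn (hs' i) (hs' j) (hs h)

theorem seqCochain_of_monotone {n k : ℕ} (hn : 2 ≤ n)
    (g : SSet.Z2Cochain (edgeComplex.{u} n).quotient k) {s : Fin (k + 1) → Finset SignedPoint}
    (h : Monotone (fun i => toEdgeCell.{u} n hn (s i))) :
    seqCochain hn g s = g (Quot.mk _ h.functor) :=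
  dif_pos h

theorem seqCochain_z2d {n k : ℕ} (hn : 2 ≤ n)
    (g : SSet.Z2Cochain (edgeComplex.{u} n).quotient k)
    {s : Fin (k + 2) → Finset SignedPoint} (hs : Monotone s) (hs' : ∀ i, IsSignCell n (s i)) :
    seqCochain hn (SSet.z2d _ k g) s = seqCoboundary (seqCochain hn g) s := by
  rw [seqCochain_of_monotone hn _ (monotone_toEdgeCell hn hs hs')]
  change ∑ i : Fin (k + 2), g ((edgeComplex.{u} n).quotient.δ i (Quot.mk _ _)) = _
  refine Finset.sum_congr rfl fun i _ => ?_
  rw [seqCochain_of_monotone hn g (monotone_toEdgeCell hn (s := fun j => s (i.succAbove j))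
    (hs.comp (Fin.strictMono_succAbove i).monotone) fun j => hs' _)]
  rfl

/-- The cochain lives on the orbit space, where a chain and its antipode are the same simplex. -/
theorem seqCochain_signFlip {n k : ℕ} (hn : 2 ≤ n)
    (g : SSet.Z2Cochain (edgeComplex.{u} n).quotient k)
    {s : Fin (k + 1) → Finset SignedPoint} (hs : Monotone s) (hs' : ∀ i, IsSignCell n (s i)) :
    seqCochain hn g (fun i => signFlip (s i)) = seqCochain hn g s := by
  rw [seqCochain_of_monotone hn g (monotone_toEdgeCell hn hs hs'),
    seqCochain_of_monotone hn g (monotone_toEdgeCell hn (s := fun i => signFlip (s i))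
      (fun i j h => Finset.map_subset_map.2 (hs h)) fun i => (hs' i).signFlip)]
  refine congrArg g (Quot.sound ?_).symm
  exact CategoryTheory.Functor.ext (fun i => (toEdgeCell_signFlip hn (hs' i)).symm)
    fun _ _ _ => Subsingleton.elim _ _

/-- The power has sum one over the `m`-hemisphere. If it were the coboundary of `g`, the sum would
be that of `g` over two antipodal hemispheres, hence zero. -/
theorem swPow_edgeComplex_ne_zero {n m : ℕ} (hm : m + 2 ≤ n) :
    (edgeComplex.{u} n).swPow m ≠ 0 := by
  have hn : 2 ≤ n := by omega
  obtain ⟨w⟩ := (edgeComplex.{u} n).nonempty_map_EZ2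
  rw [Ne, FreeZ2SSet.swPow_eq_zero_iff w]
  intro h
  have h1 : hemisphereSum m (seqCochain hn
      (SSet.z2CupPow (SSet.z2Pull w.quotient FreeZ2SSet.z) m)) = 1 := by
    rw [← hemisphereSum_colorPow (fun C => edgeCellColor w (toEdgeCell n hn C))
      (fun C hC => by rw [toEdgeCell_signFlip hn hC, edgeCellColor_invol]) m hm]
    refine hemisphereSum_congr hm fun s hs hs' => ?_
    rw [seqCochain_of_monotone hn _ (monotone_toEdgeCell hn hs hs')]
    refine (FreeZ2SSet.z2CupPow_pull_z w m _).trans (congrArg _ (funext fun i => ?_))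
    exact color_eq_edgeCellColor w _ i
  cases m with
  | zero =>
    -- In degree zero there are no nonzero coboundaries, so one vertex suffices; the default cell
    -- supplies it.
    have h0 := congrFun ((Submodule.mem_bot _).1 h)
      (Quot.mk _ (monotone_const (c := toEdgeCell.{u} n hn ∅)).functor)
    exact one_ne_zero h0
  | succ k =>
    obtain ⟨g, hg⟩ := h
    rw [← hg, hemisphereSum_congr hm fun s hs hs' => seqCochain_z2d hn g hs hs',
      hemisphereSum_seqCoboundary,
      hemisphereSum_congr (n := n) (F := fun s => seqCochain hn g fun i => signFlip (s i))
        (by omega) fun s hs hs' => seqCochain_signFlip hn g hs hs',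
      CharTwo.add_self_eq_zero] at h1
    exact zero_ne_one h1

theorem edge_isSWTestGraph : edge.{u}.IsSWTestGraph := by
  refine ⟨edge_flipsEdge, fun n hn => ⟨edge_flipsEdge, n - 2, ?_, ?_⟩⟩
  all_goals
    rw [edge_chromaticNumber] at hn
    have hn' : 2 ≤ n := by exact_mod_cast hn
  · refine ⟨swPow_edgeComplex_ne_zero (by omega), fun k hk => ?_⟩
    by_contra hlt
    exact hk (swPow_edgeComplex_eq_zero (by omega))
  · rw [edge_chromaticNumber]
    exact_mod_cast Nat.sub_add_cancel hn'

/-! ### Bipartite graphs -/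

/-- A flipped edge is an equivariant homomorphism from the graph on two vertices. -/
theorem FlipsEdge.exists_hom {V : Type u} {T : Z2Graph V} (hT : T.FlipsEdge) :
    ∃ φ : LGraph.Hom edge.{u}.toLGraph T.toLGraph, Equivariant φ := by
  obtain ⟨x, y, h, hx, hy⟩ := hT
  refine ⟨⟨fun a => if a.down = 0 then x else y, ?_⟩, ?_⟩
  · rintro ⟨a⟩ ⟨b⟩ hab
    obtain rfl : b = a + 1 := hab
    rcases zmod_two_eq_zero_or_one a with rfl | rfl
    · exact h
    · exact T.symm _ _ h
  · rintro ⟨a⟩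
    rcases zmod_two_eq_zero_or_one a with rfl | rfl
    · exact hx.symm
    · exact hy.symm

/-- A bipartition of a connected graph with a flipped edge is an equivariant homomorphism to the
graph on two vertices. -/
theorem FlipsEdge.exists_hom_edge {V : Type u} {T : Z2Graph V} (hT : T.FlipsEdge)
    (hc : T.Connected) (hb : T.Bipartite) :
    ∃ ψ : LGraph.Hom T.toLGraph edge.{u}.toLGraph, Equivariant ψ := by
  classical
  obtain ⟨S, hS⟩ := hb
  obtain ⟨x, y, h, hx, -⟩ := hT
  -- The involution exchanges the two sides: it does so at the end point `x` of the flipped edge,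
  -- and along each edge of a walk both `v` and its image change sides.
  have key : ∀ v, v ∈ S ↔ T.invol v ∉ S := by
    intro v
    induction hc.2 x v with
    | refl => rw [hx]; exact hS _ _ h
    | tail _ h2 ih =>
      have h3 := hS _ _ h2
      have h4 := hS _ _ (T.invol_adj _ _ h2)
      tauto
  refine ⟨⟨fun v => ⟨if v ∈ S then 0 else 1⟩, ?_⟩, ?_⟩
  · intro a b hab
    have h1 := hS _ _ hab
    change (if b ∈ S then (0 : ZMod 2) else 1) = (if a ∈ S then 0 else 1) + 1
    by_cases hb : b ∈ S
    · rw [if_pos hb, if_neg (by tauto)]; rfl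
    · rw [if_neg hb, if_pos (by tauto)]; rfl
  · intro v
    have h1 := key v
    apply ULift.ext
    change (if T.invol v ∈ S then (0 : ZMod 2) else 1) = (if v ∈ S then 0 else 1) + 1
    by_cases hb : v ∈ S
    · rw [if_pos hb, if_neg (by tauto)]; rfl
    · rw [if_neg hb, if_pos (by tauto)]; rfl

/-- `K₂` plays the part of both outer graphs; the two homomorphisms also force the chromatic numbers
to agree, and finiteness makes them proper. -/
theorem isSWTestGraph_of_bipartite {V : Type u} [Finite V] {T : Z2Graph V}
    (hc : T.Connected) (hb : T.Bipartite) (hT : T.FlipsEdge) : T.IsSWTestGraph := by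
  obtain ⟨φ, hφ⟩ := hT.exists_hom
  obtain ⟨ψ, hψ⟩ := hT.exists_hom_edge hc hb
  have e : T.chromaticNumber = edge.{u}.chromaticNumber :=
    le_antisymm ψ.chromaticNumber_le φ.chromaticNumber_le
  exact edge_isSWTestGraph.of_factorization edge_isSWTestGraph e e
    φ (fun _ => Set.toFinite _) hφ ψ (fun _ => Set.toFinite _) hψ

end Z2Graph

theorem mainTheorem7 :
    -- the factorization property
    (∀ (VA VT VB : Type u) (A : Z2Graph VA) (T : Z2Graph VT) (B : Z2Graph VB),
        A.IsSWTestGraph → B.IsSWTestGraph →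
        T.chromaticNumber = A.chromaticNumber → T.chromaticNumber = B.chromaticNumber →
        (∃ φ : LGraph.Hom A.toLGraph T.toLGraph, φ.Proper ∧ Z2Graph.Equivariant φ) →
        (∃ ψ : LGraph.Hom T.toLGraph B.toLGraph, ψ.Proper ∧ Z2Graph.Equivariant ψ) →
        T.IsSWTestGraph) ∧
    -- connected bipartite graphs
    (∀ (V : Type u) [Finite V] (T : Z2Graph V),
        T.Connected → T.Bipartite → T.FlipsEdge → T.IsSWTestGraph) :=
  ⟨fun _ _ _ _ _ _ hA hB eA eB ⟨φ, hφ, hφe⟩ ⟨ψ, hψ, hψe⟩ =>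
    hA.of_factorization hB eA eB φ hφ hφe ψ hψ hψe,
  fun _ _ _ hc hb hT => Z2Graph.isSWTestGraph_of_bipartite hc hb hT⟩
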